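/- Let $G$ be a finite simple undirected graph with $n$ vertices. A set of edges of $G$ is called triangle-independent if it contains at most one edge from each triangle of $G$. Let $\alpha_1(G)$ denote the maximum size of a triangle-independent set of edges of $G$, and let $\tau_B(G)$ denote the minimum size of a set of edges of $G$ whose deletion makes $G$ bipartite. If $G$ is $K_6$-free, that is, $G$ contains no complete subgraph on six vertices, then $$\alpha_1(G) + \tau_B(G) \le \frac{4403\,n^2}{15000}.$$ -/

import Mathlib

/-- A triangle-independent set of `G`: a set of edges of `G` that contains at most one edge of each
triangle of `G` (a triangle is given by its vertex set `t`, a clique with three vertices). -/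
def IsTriangleIndependent {V : Type*} (G : SimpleGraph V) (A : Finset (Sym2 V)) : Prop :=
  (A : Set (Sym2 V)) ⊆ G.edgeSet ∧
    ∀ t : Finset V, G.IsNClique 3 t →
      ∀ e ∈ A, ∀ f ∈ A, (∀ v ∈ e, v ∈ t) → (∀ v ∈ f, v ∈ t) → e = f

/-- A set of edges of `G` whose deletion makes `G` bipartite. -/
def IsBipartizing {V : Type*} (G : SimpleGraph V) (D : Finset (Sym2 V)) : Prop :=
  (D : Set (Sym2 V)) ⊆ G.edgeSet ∧ (G.deleteEdges (D : Set (Sym2 V))).IsBipartite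

/-- `α₁(G)`: the maximum size of a triangle-independent set of `G`. -/
noncomputable def alphaOne {V : Type*} (G : SimpleGraph V) : ℕ :=
  sSup {k : ℕ | ∃ A : Finset (Sym2 V), IsTriangleIndependent G A ∧ A.card = k}

/-- `τ_B(G)`: the minimum size of a set of edges of `G` whose deletion makes `G` bipartite. -/
noncomputable def tauB {V : Type*} (G : SimpleGraph V) : ℕ :=
  sInf {k : ℕ | ∃ D : Finset (Sym2 V), IsBipartizing G D ∧ D.card = k}

/-- For a finite graph the supremum defining `α₁(G)` is a maximum. -/
theorem alphaOne_isGreatest {V : Type*} [Finite V] (G : SimpleGraph V) :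
    IsGreatest {k : ℕ | ∃ A : Finset (Sym2 V), IsTriangleIndependent G A ∧ A.card = k}
      (alphaOne G) := by
  have hb : BddAbove {k : ℕ | ∃ A : Finset (Sym2 V), IsTriangleIndependent G A ∧ A.card = k} := by
    have := Fintype.ofFinite (Sym2 V)
    refine ⟨Fintype.card (Sym2 V), ?_⟩
    rintro k ⟨A, -, rfl⟩
    exact Finset.card_le_univ A
  exact ⟨Nat.sSup_mem ⟨0, ∅, ⟨by simp, by simp⟩, rfl⟩ hb, fun k hk => le_csSup hb hk⟩

/-- For a finite graph the infimum defining `τ_B(G)` is a minimum. -/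
theorem tauB_isLeast {V : Type*} [Finite V] (G : SimpleGraph V) :
    IsLeast {k : ℕ | ∃ D : Finset (Sym2 V), IsBipartizing G D ∧ D.card = k} (tauB G) := by
  refine ⟨Nat.sInf_mem ⟨_, (Set.toFinite G.edgeSet).toFinset, ⟨by simp, ?_⟩, rfl⟩,
    fun k hk => Nat.sInf_le hk⟩
  refine ⟨SimpleGraph.Coloring.mk (fun _ => 0) ?_⟩
  intro v w h
  simp at h

/-! Fix a maximum triangle-independent set `A`, let `a` and `g` be the indicators of `A` and `G`,
and put κ = 4403/7500. The monochromatic edges of a two-colouring form a bipartizing set, so it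
suffices to find a colouring for which `A` and the monochromatic edges together number at most
κn²/2. Over ordered pairs the bound is κ|W|², and it is proved for every vertex set `W` by
induction.

In a minimal counterexample no nonempty `S` is cheap to remove: colour `S` and `W \ S` separately,
then flip one side so that at most half of the cross edges are monochromatic
(`exists_coloring_extend`). Two kinds of `S` are used. A single vertex `u` bounds its number `P u`
of non-neighbours in `G` by its degree `d u` in `A`. For an edge xy of `A`, take the union of the
`A`-neighbourhoods of x and y. Each is independent in `G`, and they are disjoint because `A` is
triangle-free, so giving them opposite colours leaves no monochromatic edge inside `S`.

By `sum_neighborhoods_cost` and `edge_estimate`, a certain defect of each edge xy then exceeds (P x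
- P y)(d x - d y). Double counting walks of length three in `A` (`sum_edge_defect_le`) gives the
opposite inequality after summing over all edges, a contradiction. -/

/-! ### Gluing two-colourings -/

open Finset in
/-- If the vertices of `S` and of `W \ S` are coloured, then flipping the colours on `S` if necessary
makes at most half of the cross weight monochromatic. -/
theorem exists_coloring_extend {V : Type*} [DecidableEq V] {a g : V → V → ℝ}
    (asymm : ∀ u v, a u v = a v u) (gsymm : ∀ u v, g u v = g v u)
    {W S : Finset V} (hS : S ⊆ W) (c₁ c₂ : V → Bool) :
    ∃ c : V → Bool,
      ∑ u ∈ W, ∑ v ∈ W, (a u v + g u v * (if c u = c v then 1 else 0)) ≤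
        ∑ u ∈ S, ∑ v ∈ S, (a u v + g u v * (if c₁ u = c₁ v then 1 else 0)) +
        ∑ u ∈ W \ S, ∑ v ∈ W \ S, (a u v + g u v * (if c₂ u = c₂ v then 1 else 0)) +
        ∑ u ∈ S, ∑ v ∈ W \ S, (2 * a u v + g u v) := by
  let t : Bool → ℝ := fun b =>
    ∑ u ∈ S, ∑ v ∈ W \ S, g u v * (if (xor (c₁ u) b) = c₂ v then 1 else 0)
  -- Each cross pair is monochromatic for exactly one value of the flip.
  have ht : t true + t false = ∑ u ∈ S, ∑ v ∈ W \ S, g u v := by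
    simp only [t, ← sum_add_distrib]
    refine sum_congr rfl fun u _ => sum_congr rfl fun v _ => ?_
    cases c₁ u <;> cases c₂ v <;> simp
  obtain ⟨b, hb⟩ : ∃ b, 2 * t b ≤ ∑ u ∈ S, ∑ v ∈ W \ S, g u v := by
    by_contra! h
    linarith [h true, h false]
  let c : V → Bool := fun u => if u ∈ S then xor (c₁ u) b else c₂ u
  refine ⟨c, ?_⟩
  let φ : V → V → ℝ := fun u v => a u v + g u v * (if c u = c v then 1 else 0)
  have φsymm : ∀ u v, φ u v = φ v u := fun u v => by
    simp only [φ, asymm u v, gsymm u v, eq_comm]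
  have split : ∀ f : V → ℝ, ∑ u ∈ W, f u = ∑ u ∈ S, f u + ∑ u ∈ W \ S, f u := fun f => by
    rw [add_comm, sum_sdiff hS]
  have h1 : ∑ u ∈ W, ∑ v ∈ W, φ u v = ∑ u ∈ S, ∑ v ∈ S, φ u v
      + ∑ u ∈ W \ S, ∑ v ∈ W \ S, φ u v + 2 * ∑ u ∈ S, ∑ v ∈ W \ S, φ u v := by
    have hc : ∑ u ∈ W \ S, ∑ v ∈ S, φ u v = ∑ u ∈ S, ∑ v ∈ W \ S, φ u v := by
      rw [sum_comm]
      exact sum_congr rfl fun u _ => sum_congr rfl fun v _ => φsymm _ _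
    simp only [split, sum_add_distrib]
    linarith
  have h2 : ∑ u ∈ S, ∑ v ∈ S, φ u v =
      ∑ u ∈ S, ∑ v ∈ S, (a u v + g u v * (if c₁ u = c₁ v then 1 else 0)) := by
    refine sum_congr rfl fun u hu => sum_congr rfl fun v hv => ?_
    simp only [φ, c, hu, hv, if_true]
    cases c₁ u <;> cases c₁ v <;> cases b <;> simp
  have h3 : ∑ u ∈ W \ S, ∑ v ∈ W \ S, φ u v =
      ∑ u ∈ W \ S, ∑ v ∈ W \ S, (a u v + g u v * (if c₂ u = c₂ v then 1 else 0)) := by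
    refine sum_congr rfl fun u hu => sum_congr rfl fun v hv => ?_
    simp only [φ, c, (mem_sdiff.1 hu).2, (mem_sdiff.1 hv).2, if_false]
  have h4 : ∑ u ∈ S, ∑ v ∈ W \ S, φ u v = ∑ u ∈ S, ∑ v ∈ W \ S, a u v + t b := by
    simp only [t, ← sum_add_distrib]
    refine sum_congr rfl fun u hu => sum_congr rfl fun v hv => ?_
    simp only [φ, c, hu, (mem_sdiff.1 hv).2, if_true, if_false]
  have h5 : ∑ u ∈ S, ∑ v ∈ W \ S, (2 * a u v + g u v) =
      2 * ∑ u ∈ S, ∑ v ∈ W \ S, a u v + ∑ u ∈ S, ∑ v ∈ W \ S, g u v := by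
    simp only [sum_add_distrib, mul_sum]
  change ∑ u ∈ W, ∑ v ∈ W, φ u v ≤ _
  linarith

/-! ### Double counting in a triangle-free graph -/

open Finset in
/-- Summing the vertex weights `h` over the neighbourhoods of both ends of all edges. -/
theorem sum_edge_sum_neighbors {V : Type*} {a : V → V → ℝ} (asymm : ∀ u v, a u v = a v u)
    (W : Finset V) (h : V → ℝ) :
    ∑ x ∈ W, ∑ y ∈ W, a x y * ∑ u ∈ W, (a x u + a y u) * h u =
      2 * ∑ u ∈ W, ∑ x ∈ W, h u * (a u x * ∑ y ∈ W, a x y) := by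
  have h1 : ∑ x ∈ W, ∑ y ∈ W, a x y * ∑ u ∈ W, a x u * h u =
      ∑ u ∈ W, ∑ x ∈ W, h u * (a u x * ∑ y ∈ W, a x y) := by
    rw [sum_comm (s := W) (t := W) (f := fun u x => h u * (a u x * ∑ y ∈ W, a x y))]
    refine sum_congr rfl fun x _ => ?_
    rw [← sum_mul, mul_sum]
    refine sum_congr rfl fun u _ => ?_
    rw [asymm u x]; ring
  have h2 : ∑ x ∈ W, ∑ y ∈ W, a x y * ∑ u ∈ W, a y u * h u =
      ∑ x ∈ W, ∑ y ∈ W, a x y * ∑ u ∈ W, a x u * h u := by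
    rw [sum_comm]
    refine sum_congr rfl fun x _ => sum_congr rfl fun y _ => ?_
    rw [asymm y x]
  simp only [add_mul, sum_add_distrib, mul_add]
  linarith

open Finset in
/-- The sum over all edges `xy` of the number of edges between the neighbourhoods of `x` and `y` is
the sum of the squared codegrees. -/
theorem sum_edge_edges_between_neighbors {V : Type*} {a : V → V → ℝ}
    (asymm : ∀ u v, a u v = a v u) (W : Finset V) :
    ∑ x ∈ W, ∑ y ∈ W, a x y * ∑ u ∈ W, ∑ v ∈ W, a x u * a y v * a u v =
      ∑ x ∈ W, ∑ v ∈ W, (∑ w ∈ W, a x w * a v w) ^ 2 := by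
  refine sum_congr rfl fun x _ => ?_
  have : ∀ v, (∑ w ∈ W, a x w * a v w) ^ 2 =
      ∑ y ∈ W, ∑ u ∈ W, a x y * (a x u * a y v * a u v) := fun v => by
    rw [sq, sum_mul_sum]
    refine sum_congr rfl fun y _ => sum_congr rfl fun u _ => ?_
    rw [asymm v y, asymm v u]; ring
  simp only [this, mul_sum]
  rw [sum_comm (s := W) (t := W) (f := fun v y => ∑ u ∈ W, a x y * (a x u * a y v * a u v))]
  exact sum_congr rfl fun y _ => sum_comm

open Finset in
/-- In a triangle-free graph, the walks of length three from `u` to `v` avoid the common neighbours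
of `u` and `v`. -/
theorem walks_three_le {V : Type*} {a : V → V → ℝ} (a01 : ∀ u v, a u v = 0 ∨ a u v = 1)
    (asymm : ∀ u v, a u v = a v u) (tri : ∀ x y z, a x y * a y z * a x z = 0)
    (W : Finset V) (u v : V) :
    ∑ x ∈ W, ∑ y ∈ W, a x y * (a x u * a y v) ≤
      (∑ x ∈ W, a u x - ∑ x ∈ W, a u x * a v x) *
        (∑ x ∈ W, a v x - ∑ x ∈ W, a u x * a v x) := by
  rw [← sum_sub_distrib, ← sum_sub_distrib, sum_mul_sum]
  -- Termwise: on a walk u, x, y, v, the vertex x is not adjacent to v, nor y to u, since xyv or xyu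
  -- would be a triangle.
  refine sum_le_sum fun x _ => sum_le_sum fun y _ => ?_
  have t1 := tri x y v
  have t2 := tri x y u
  rw [asymm u x, asymm v x, asymm u y, asymm v y]
  rcases a01 x y with h1 | h1 <;> rcases a01 x u with h2 | h2 <;> rcases a01 y v with h3 | h3 <;>
    rcases a01 x v with h4 | h4 <;> rcases a01 y u with h5 | h5 <;>
    simp_all

open Finset in
/-- The main counting inequality. Here `a` is a triangle-free graph and `q` contains all pairs with a
common neighbour. -/
theorem sum_edge_defect_le {V : Type*} {a q : V → V → ℝ} (a01 : ∀ u v, a u v = 0 ∨ a u v = 1)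
    (q01 : ∀ u v, q u v = 0 ∨ q u v = 1)
    (asymm : ∀ u v, a u v = a v u) (qsymm : ∀ u v, q u v = q v u)
    (tri : ∀ x y z, a x y * a y z * a x z = 0)
    (haq : ∀ u v w, a u w * a v w * (1 - q u v) = 0) (W : Finset V)
    {d P : V → ℝ} (hd : ∀ u, d u = ∑ v ∈ W, a u v) (hP : ∀ u, P u = ∑ v ∈ W, q u v) :
    ∑ x ∈ W, ∑ y ∈ W, a x y * (2 * ∑ u ∈ W, (a x u + a y u) * d u
        - 2 * ∑ u ∈ W, ∑ v ∈ W, a x u * a y v * a u v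
        + 2 * ∑ u ∈ W, ∑ v ∈ W, a x u * a y v * q u v
        - ∑ u ∈ W, (a x u + a y u) * P u) ≤
      ∑ x ∈ W, ∑ y ∈ W, a x y * ((P x - P y) * (d x - d y)) := by
  have e1 := sum_edge_sum_neighbors asymm W d
  have e2 := sum_edge_sum_neighbors asymm W P
  have e3 := sum_edge_edges_between_neighbors asymm W
  simp only [← hd] at e1 e2
  have e4 : ∑ x ∈ W, ∑ y ∈ W, a x y * ∑ u ∈ W, ∑ v ∈ W, a x u * a y v * q u v =
      ∑ u ∈ W, ∑ v ∈ W, q u v * ∑ x ∈ W, ∑ y ∈ W, a x y * (a x u * a y v) := by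
    simp only [mul_sum]
    calc _ = ∑ x ∈ W, ∑ u ∈ W, ∑ y ∈ W, ∑ v ∈ W, a x y * (a x u * a y v * q u v) :=
          sum_congr rfl fun x _ => sum_comm
      _ = ∑ u ∈ W, ∑ x ∈ W, ∑ y ∈ W, ∑ v ∈ W, a x y * (a x u * a y v * q u v) := sum_comm
      _ = ∑ u ∈ W, ∑ x ∈ W, ∑ v ∈ W, ∑ y ∈ W, a x y * (a x u * a y v * q u v) :=
          sum_congr rfl fun u _ => sum_congr rfl fun x _ => sum_comm
      _ = ∑ u ∈ W, ∑ v ∈ W, ∑ x ∈ W, ∑ y ∈ W, a x y * (a x u * a y v * q u v) :=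
          sum_congr rfl fun u _ => sum_comm
      _ = _ := by
          refine sum_congr rfl fun u _ => sum_congr rfl fun v _ => sum_congr rfl fun x _ =>
            sum_congr rfl fun y _ => ?_
          ring
  -- Expand the product in `walks_three_le` and use 2 d(u) d(v) ≤ d(u)² + d(v)². Where `q` vanishes
  -- the codegree is zero, so the codegree terms need no factor `q`.
  have e5 : ∑ u ∈ W, ∑ v ∈ W, q u v * ∑ x ∈ W, ∑ y ∈ W, a x y * (a x u * a y v) ≤
      ∑ u ∈ W, ∑ v ∈ W, (q u v * (d u ^ 2 + d v ^ 2) / 2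
        - (d u + d v) * ∑ x ∈ W, a u x * a v x + (∑ x ∈ W, a u x * a v x) ^ 2) := by
    refine sum_le_sum fun u _ => sum_le_sum fun v _ => ?_
    have h := walks_three_le a01 asymm tri W u v
    rw [← hd, ← hd] at h
    rcases q01 u v with hq | hq
    · have : ∑ x ∈ W, a u x * a v x = 0 := sum_eq_zero fun x _ => by
        have := haq u v x
        rw [hq] at this
        linarith
      simp [hq, this]
    · rw [hq]
      nlinarith [sq_nonneg (d u - d v)]
  have e6 : ∑ u ∈ W, ∑ v ∈ W, q u v * (d u ^ 2 + d v ^ 2) / 2 = ∑ u ∈ W, P u * d u ^ 2 := by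
    have h : ∑ u ∈ W, ∑ v ∈ W, q u v * d v ^ 2 = ∑ u ∈ W, ∑ v ∈ W, q u v * d u ^ 2 := by
      rw [sum_comm]
      exact sum_congr rfl fun u _ => sum_congr rfl fun v _ => by rw [qsymm]
    have h' : ∑ u ∈ W, ∑ v ∈ W, q u v * d u ^ 2 = ∑ u ∈ W, P u * d u ^ 2 :=
      sum_congr rfl fun u _ => by rw [hP, sum_mul]
    simp only [← sum_div, mul_add, sum_add_distrib]
    linarith
  have e7 : ∑ u ∈ W, ∑ v ∈ W, (d u + d v) * ∑ x ∈ W, a u x * a v x =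
      2 * ∑ u ∈ W, ∑ x ∈ W, d u * (a u x * d x) := by
    have h : ∑ u ∈ W, ∑ v ∈ W, d u * ∑ x ∈ W, a u x * a v x =
        ∑ u ∈ W, ∑ x ∈ W, d u * (a u x * d x) := by
      refine sum_congr rfl fun u _ => ?_
      simp only [mul_sum]
      rw [sum_comm]
      refine sum_congr rfl fun x _ => ?_
      rw [hd x, mul_sum, mul_sum]
      exact sum_congr rfl fun v _ => by rw [asymm v x]
    have h' : ∑ u ∈ W, ∑ v ∈ W, d v * ∑ x ∈ W, a u x * a v x =
        ∑ u ∈ W, ∑ v ∈ W, d u * ∑ x ∈ W, a u x * a v x := by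
      rw [sum_comm]
      refine sum_congr rfl fun u _ => sum_congr rfl fun v _ => ?_
      congr 1
      exact sum_congr rfl fun x _ => mul_comm _ _
    simp only [add_mul, sum_add_distrib]
    linarith
  have e8 : ∑ x ∈ W, ∑ y ∈ W, a x y * ((P x - P y) * (d x - d y)) =
      2 * ∑ u ∈ W, P u * d u ^ 2 - 2 * ∑ u ∈ W, ∑ x ∈ W, P u * (a u x * d x) := by
    have h1 : ∑ x ∈ W, ∑ y ∈ W, a x y * (P x * d x) = ∑ u ∈ W, P u * d u ^ 2 :=
      sum_congr rfl fun x _ => by rw [← sum_mul, ← hd]; ring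
    have h2 : ∑ x ∈ W, ∑ y ∈ W, a x y * (P y * d y) = ∑ x ∈ W, ∑ y ∈ W, a x y * (P x * d x) := by
      rw [sum_comm]
      exact sum_congr rfl fun u _ => sum_congr rfl fun v _ => by rw [asymm]
    have h3 : ∑ x ∈ W, ∑ y ∈ W, a x y * (P y * d x) = ∑ x ∈ W, ∑ y ∈ W, P x * (a x y * d y) := by
      rw [sum_comm]
      exact sum_congr rfl fun u _ => sum_congr rfl fun v _ => by rw [asymm]; ring
    have h4 : ∑ x ∈ W, ∑ y ∈ W, a x y * ((P x - P y) * (d x - d y)) =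
        ∑ x ∈ W, ∑ y ∈ W, a x y * (P x * d x) + ∑ x ∈ W, ∑ y ∈ W, a x y * (P y * d y)
        - ∑ x ∈ W, ∑ y ∈ W, a x y * (P y * d x) - ∑ x ∈ W, ∑ y ∈ W, P x * (a x y * d y) := by
      simp only [← sum_add_distrib, ← sum_sub_distrib]
      exact sum_congr rfl fun u _ => sum_congr rfl fun v _ => by ring
    linarith
  simp only [sum_add_distrib, sum_sub_distrib] at e5
  have e9 : ∀ f₁ f₂ f₃ f₄ : V → V → ℝ,
      ∑ x ∈ W, ∑ y ∈ W, a x y * (2 * f₁ x y - 2 * f₂ x y + 2 * f₃ x y - f₄ x y) =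
      2 * ∑ x ∈ W, ∑ y ∈ W, a x y * f₁ x y - 2 * ∑ x ∈ W, ∑ y ∈ W, a x y * f₂ x y
      + 2 * ∑ x ∈ W, ∑ y ∈ W, a x y * f₃ x y - ∑ x ∈ W, ∑ y ∈ W, a x y * f₄ x y := by
    intro f₁ f₂ f₃ f₄
    simp only [mul_sum, ← sum_add_distrib, ← sum_sub_distrib]
    exact sum_congr rfl fun u _ => sum_congr rfl fun v _ => by ring
  -- The squared codegrees of `e3` and `e5` cancel, as do the degree products of `e1` and `e7`. What
  -- remains, from `e6` and `e2`, is the right side by `e8`.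
  rw [e9]
  linarith

/-! ### Numerical estimate for one edge -/

/-- The numerical estimate for an edge whose ends have degrees `b ≤ a`. -/
theorem edge_estimate_of_le {n a b p r : ℝ} (hn : 4 ≤ n ∨ n ≤ 3) (hb : 1 ≤ b) (hba : b ≤ a)
    (hab : a + b ≤ n) (hpn : p ≤ n - a) (hra : a ≤ r)
    (hp : p < 2 * a + n - 4403 / 7500 * (2 * n - 1))
    (hr : r < 2 * b + n - 4403 / 7500 * (2 * n - 1)) :
    (p - r) * (a - b) + (a - b) ^ 2 / 2 ≤ 653 / 7500 * ((2 * n - (a + b)) * (a + b)) := by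
  obtain ⟨t, ht0, rfl⟩ : ∃ t, 0 ≤ t ∧ a = b + t := ⟨a - b, by linarith, by ring⟩
  have hpr : p - r ≤ n - 2 * (b + t) := by linarith
  rcases hn with hn | hn
  · have hp' : p - r ≤ b + t - n / 40 := by linarith
    have htb : t ≤ b - n / 40 := by linarith
    -- Split by which bound on p - r is smaller. The slacks are w for `htb`, z for `h`, and in the
    -- second case y = n - (a + b); in these variables the inequality follows from products of
    -- nonnegative quantities.
    rcases le_total (b + t - n / 40) (n - 2 * (b + t)) with h | h
    · have : (p - r) * t ≤ (b + t - n / 40) * t := mul_le_mul_of_nonneg_right hp' ht0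
      obtain ⟨w, hw, rfl⟩ : ∃ w, 0 ≤ w ∧ b = t + n / 40 + w :=
        ⟨b - n / 40 - t, by linarith, by ring⟩
      obtain ⟨z, hz, rfl⟩ : ∃ z, 0 ≤ z ∧ n = 20 / 19 * (6 * t + 3 * w + z) :=
        ⟨19 / 20 * n - 6 * t - 3 * w, by linarith, by ring⟩
      nlinarith [mul_nonneg ht0 ht0, mul_nonneg ht0 hw, mul_nonneg ht0 hz, mul_nonneg hw hw,
        mul_nonneg hw hz, mul_nonneg hz hz]
    · have : (p - r) * t ≤ (n - 2 * (b + t)) * t := mul_le_mul_of_nonneg_right hpr ht0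
      obtain ⟨w, hw, rfl⟩ : ∃ w, 0 ≤ w ∧ b = t + n / 40 + w :=
        ⟨b - n / 40 - t, by linarith, by ring⟩
      obtain ⟨y, hy, rfl⟩ : ∃ y, 0 ≤ y ∧ n = 20 / 19 * (3 * t + 2 * w + y) :=
        ⟨19 / 20 * n - 3 * t - 2 * w, by linarith, by ring⟩
      have hyt : 0 ≤ 3 * t + w - y := by linarith
      nlinarith [mul_nonneg ht0 ht0, mul_nonneg ht0 hw, mul_nonneg ht0 hyt, mul_nonneg hw hw,
        mul_nonneg hw hy, mul_nonneg hy hy]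
  · have : (p - r) * t ≤ (n - 2 * (b + t)) * t := mul_le_mul_of_nonneg_right hpr ht0
    nlinarith [mul_nonneg ht0 ht0, mul_nonneg (sub_nonneg.2 hb) ht0]

theorem edge_estimate {n a b p r : ℝ} (hn : 4 ≤ n ∨ n ≤ 3) (ha : 1 ≤ a) (hb : 1 ≤ b)
    (hpn : p ≤ n - a) (hrn : r ≤ n - b) (hra : a ≤ r) (hpb : b ≤ p)
    (hp : p < 2 * a + n - 4403 / 7500 * (2 * n - 1))
    (hr : r < 2 * b + n - 4403 / 7500 * (2 * n - 1)) :
    (p - r) * (a - b) + (a - b) ^ 2 / 2 ≤ 653 / 7500 * ((2 * n - (a + b)) * (a + b)) := by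
  rcases le_total b a with h | h
  · exact edge_estimate_of_le hn hb h (by linarith) hpn hra hp hr
  · have := edge_estimate_of_le hn ha h (by linarith) hrn hpb hr hp
    rw [add_comm b a] at this
    linarith

/-! ### Cost of removing two neighbourhoods -/

open Finset in
/-- The weight that has to be added when the two disjoint neighbourhoods of `x` and `y` are coloured
with two colours and joined to the rest of the graph. -/
theorem sum_neighborhoods_cost {V : Type*} [DecidableEq V] {a g : V → V → ℝ}
    (a01 : ∀ u v, a u v = 0 ∨ a u v = 1)
    (asymm : ∀ u v, a u v = a v u) (gsymm : ∀ u v, g u v = g v u)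
    (tri : ∀ x y z, a x y * a y z * a x z = 0)
    (hag : ∀ u v w, a u w * a v w * g u v = 0) (W : Finset V)
    {d P : V → ℝ} (hd : ∀ u, d u = ∑ v ∈ W, a u v) (hP : ∀ u, P u = ∑ v ∈ W, (1 - g u v))
    {x y : V} (hxy : a x y = 1) :
    ∃ (S : Finset V) (c : V → Bool), S ⊆ W ∧ (S.card : ℝ) = d x + d y ∧
      ∑ u ∈ S, ∑ v ∈ S, (a u v + g u v * (if c u = c v then 1 else 0)) +
        ∑ u ∈ S, ∑ v ∈ W \ S, (2 * a u v + g u v) =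
      2 * ∑ u ∈ W, (a x u + a y u) * d u
        - 2 * ∑ u ∈ W, ∑ v ∈ W, a x u * a y v * a u v
        + 2 * ∑ u ∈ W, ∑ v ∈ W, a x u * a y v * (1 - g u v)
        - ∑ u ∈ W, (a x u + a y u) * P u
        + (d x ^ 2 + d y ^ 2 + (d x + d y) * (W.card - (d x + d y))) := by
  classical
  have disj : ∀ u, a x u = 1 → a y u = 0 := fun u hu => by
    have := tri x y u
    rw [hxy, hu] at this
    linarith
  let S := W.filter fun u => a x u = 1 ∨ a y u = 1
  let c : V → Bool := fun u => decide (a x u = 1)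
  have hS : S ⊆ W := filter_subset _ _
  have sumS : ∀ f : V → ℝ, ∑ u ∈ S, f u = ∑ u ∈ W, (a x u + a y u) * f u := fun f => by
    rw [sum_filter]
    refine sum_congr rfl fun u _ => ?_
    have := disj u
    rcases a01 x u with h1 | h1 <;> rcases a01 y u with h2 | h2 <;> simp_all
  have hcard : (S.card : ℝ) = d x + d y := by
    have := sumS fun _ => 1
    simpa [sum_add_distrib, ← hd] using this
  refine ⟨S, c, hS, hcard, ?_⟩
  have inX : ∀ f : V → V → ℝ, ∑ u ∈ S, ∑ v ∈ S, f u v =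
      ∑ u ∈ W, ∑ v ∈ W, (a x u * a x v * f u v + a y u * a y v * f u v
        + a x u * a y v * f u v + a x v * a y u * f u v) := fun f => by
    rw [sumS]
    refine sum_congr rfl fun u _ => ?_
    rw [sumS, mul_sum]
    exact sum_congr rfl fun v _ => by ring
  have flip : ∀ f : V → V → ℝ, (∀ u v, f u v = f v u) →
      ∑ u ∈ W, ∑ v ∈ W, a x v * a y u * f u v = ∑ u ∈ W, ∑ v ∈ W, a x u * a y v * f u v :=
    fun f hf => by
      rw [sum_comm]
      exact sum_congr rfl fun u _ => sum_congr rfl fun v _ => by rw [hf]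
  have T : ∀ x u v, a x u * a x v * a u v = 0 := fun x u v => by
    have := tri x u v
    linear_combination this
  have G : ∀ x u v, a x u * a x v * g u v = 0 := fun x u v => by
    have := hag u v x
    rw [asymm x u, asymm x v, this]
  have inner : ∑ u ∈ S, ∑ v ∈ S, (a u v + g u v * (if c u = c v then 1 else 0)) =
      2 * ∑ u ∈ W, ∑ v ∈ W, a x u * a y v * a u v := by
    -- Both colour classes are independent in `g`, so no monochromatic pair contributes.
    have h : ∑ u ∈ S, ∑ v ∈ S, (a u v + g u v * (if c u = c v then 1 else 0)) =
        ∑ u ∈ S, ∑ v ∈ S, a u v := by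
      refine sum_congr rfl fun u hu => sum_congr rfl fun v hv => ?_
      have hu' := (mem_filter.1 hu).2
      have hv' := (mem_filter.1 hv).2
      have g1 := G x u v
      have g2 := G y u v
      by_cases h1 : a x u = 1 <;> by_cases h2 : a x v = 1 <;> simp_all [c]
    rw [h, inX]
    simp only [T, zero_add, sum_add_distrib]
    rw [flip a asymm]; ring
  -- By the same independence all ordered pairs inside one neighbourhood, the diagonal included, are
  -- non-edges; this gives the two squares.
  have hq : ∑ u ∈ S, ∑ v ∈ S, (1 - g u v) =
      d x ^ 2 + d y ^ 2 + 2 * ∑ u ∈ W, ∑ v ∈ W, a x u * a y v * (1 - g u v) := by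
    have sqd : ∀ x, ∑ u ∈ W, ∑ v ∈ W, a x u * a x v * (1 - g u v) = d x ^ 2 := fun x => by
      rw [hd, sq, sum_mul_sum]
      refine sum_congr rfl fun u _ => sum_congr rfl fun v _ => ?_
      linear_combination -(G x u v)
    rw [inX]
    simp only [sum_add_distrib]
    rw [flip (fun u v => 1 - g u v) (fun u v => by rw [gsymm]), sqd, sqd]; ring
  have ha : ∑ u ∈ S, ∑ v ∈ S, a u v = 2 * ∑ u ∈ W, ∑ v ∈ W, a x u * a y v * a u v := by
    rw [inX]
    simp only [T, zero_add, sum_add_distrib]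
    rw [flip a asymm]; ring
  have out : ∀ f : V → V → ℝ, ∑ u ∈ S, ∑ v ∈ W \ S, f u v =
      ∑ u ∈ S, ∑ v ∈ W, f u v - ∑ u ∈ S, ∑ v ∈ S, f u v := fun f => by
    rw [← sum_sub_distrib]
    refine sum_congr rfl fun u _ => ?_
    rw [← sum_sdiff hS]; ring
  have o1 := out a
  have o2 := out fun u v => 1 - g u v
  simp only [← hd, ← hP] at o1 o2
  rw [sumS d] at o1
  rw [sumS P] at o2
  have o3 : ∑ u ∈ S, ∑ v ∈ W \ S, (2 * a u v + g u v) = 2 * ∑ u ∈ S, ∑ v ∈ W \ S, a u v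
      - ∑ u ∈ S, ∑ v ∈ W \ S, (1 - g u v) + (d x + d y) * (W.card - (d x + d y)) := by
    have hc : ((W \ S).card : ℝ) = W.card - (d x + d y) := by
      rw [← hcard, cast_card_sdiff hS]
    rw [← hc]
    have : ∑ u ∈ S, ∑ v ∈ W \ S, (1 : ℝ) = S.card * (W \ S).card := by simp
    rw [hcard] at this
    rw [← this, mul_sum, ← sum_sub_distrib, ← sum_add_distrib]
    refine sum_congr rfl fun u _ => ?_
    rw [mul_sum, ← sum_sub_distrib, ← sum_add_distrib]
    exact sum_congr rfl fun v _ => by ring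
  rw [inner, o3]
  linarith

/-! ### The minimal counterexample -/

open Finset in
/-- For a graph `a` contained in a graph `g`, no two edges of `a` lying in a common triangle of `g`,
some two-colouring has few edges of `g` that are monochromatic. Sums are over ordered pairs. -/
theorem exists_coloring_sum_le {V : Type*} {a g : V → V → ℝ}
    (a01 : ∀ u v, a u v = 0 ∨ a u v = 1) (g01 : ∀ u v, g u v = 0 ∨ g u v = 1)
    (asymm : ∀ u v, a u v = a v u) (gsymm : ∀ u v, g u v = g v u)
    (gself : ∀ u, g u u = 0) (le : ∀ u v, a u v ≤ g u v)
    (hag : ∀ u v w, a u w * a v w * g u v = 0) (W : Finset V) :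
    ∃ c : V → Bool, ∑ u ∈ W, ∑ v ∈ W, (a u v + g u v * (if c u = c v then 1 else 0)) ≤
      4403 / 7500 * (W.card : ℝ) ^ 2 := by
  classical
  have a0 : ∀ u v, 0 ≤ a u v := fun u v => by rcases a01 u v with h | h <;> simp [h]
  have tri : ∀ x y z, a x y * a y z * a x z = 0 := fun x y z => by
    have h := hag x z y
    have hle := le x z
    rw [asymm y z]
    rcases a01 x z with h1 | h1
    · simp [h1]
    · rcases g01 x z with h2 | h2
      · linarith
      · rw [h1, ← h2, h]
  induction W using Finset.strongInduction with
  | H W ih =>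
  rcases W.eq_empty_or_nonempty with rfl | hne
  · exact ⟨fun _ => true, by simp⟩
  by_contra! hW
  set n : ℝ := (W.card : ℝ) with hn
  -- Otherwise the induction colouring of `W \ S` would extend to `W`; the left factor is n² - (n -
  -- |S|)².
  have key : ∀ S ⊆ W, S.Nonempty → ∀ c : V → Bool,
      4403 / 7500 * ((2 * n - S.card) * S.card) <
      ∑ u ∈ S, ∑ v ∈ S, (a u v + g u v * (if c u = c v then 1 else 0)) +
        ∑ u ∈ S, ∑ v ∈ W \ S, (2 * a u v + g u v) := by
    intro S hS hSne c
    obtain ⟨c₂, h₂⟩ := ih (W \ S) (sdiff_ssubset hS hSne)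
    obtain ⟨c₃, h₃⟩ := exists_coloring_extend asymm gsymm hS c c₂
    have h₄ := hW c₃
    rw [cast_card_sdiff hS, ← hn] at h₂
    linarith
  let d : V → ℝ := fun u => ∑ v ∈ W, a u v
  let P : V → ℝ := fun u => ∑ v ∈ W, (1 - g u v)
  have hd : ∀ u, d u = ∑ v ∈ W, a u v := fun _ => rfl
  have hP : ∀ u, P u = ∑ v ∈ W, (1 - g u v) := fun _ => rfl
  have vert : ∀ u ∈ W, P u < 2 * d u + n - 4403 / 7500 * (2 * n - 1) := by
    intro u hu
    have h := key {u} (by simpa using hu) (by simp) fun _ => true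
    have hau : a u u = 0 := le_antisymm (by simpa [gself] using le u u) (a0 u u)
    have h1 : ∑ v ∈ W \ {u}, (2 * a u v + g u v) = 2 * d u + n - P u := by
      have : ∑ v ∈ W, (2 * a u v + g u v) = 2 * d u + n - P u := by
        simp only [d, P, sum_add_distrib, sum_sub_distrib, ← mul_sum]
        simp [hn]
        ring
      rw [← this, ← sum_sdiff (show {u} ⊆ W by simpa using hu)]
      simp [hau, gself]
    simp only [sum_singleton, h1, hau, gself, card_singleton, Nat.cast_one] at h
    linarith
  have dpos : ∀ x ∈ W, ∀ y ∈ W, a x y = 1 → 1 ≤ d x := fun x _ y hy h => by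
    rw [← h]
    exact single_le_sum (f := fun y => a x y) (fun v _ => a0 x v) hy
  have Ple : ∀ x, P x ≤ n - d x := fun x => by
    have : n - d x = ∑ v ∈ W, (1 - a x v) := by simp [d, sum_sub_distrib, hn]
    rw [this]
    exact sum_le_sum fun v _ => by linarith [le x v]
  -- The `a`-neighbourhood of x contains y and is independent in `g`, so it consists of
  -- non-neighbours of y, y itself included.
  have leP : ∀ x y, a x y = 1 → d x ≤ P y := fun x y h => by
    refine sum_le_sum fun v _ => ?_
    have h1 := hag y v x
    rw [asymm y x, h, asymm v x] at h1
    rcases a01 x v with h2 | h2 <;> rcases g01 y v with h3 | h3 <;> simp_all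
  have edge : ∀ x ∈ W, ∀ y ∈ W, a x y = 1 →
      0 < 2 * ∑ u ∈ W, (a x u + a y u) * d u
        - 2 * ∑ u ∈ W, ∑ v ∈ W, a x u * a y v * a u v
        + 2 * ∑ u ∈ W, ∑ v ∈ W, a x u * a y v * (1 - g u v)
        - ∑ u ∈ W, (a x u + a y u) * P u - (P x - P y) * (d x - d y) := by
    intro x hx y hy hxy
    obtain ⟨S, c, hS, hcard, hsum⟩ :=
      sum_neighborhoods_cost a01 asymm gsymm tri hag W hd hP hxy
    have hx1 := dpos x hx y hy hxy
    have hy1 := dpos y hy x hx (by rw [asymm, hxy])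
    have hSne : S.Nonempty := by
      rw [← card_pos]
      have : (0 : ℝ) < S.card := by linarith
      exact_mod_cast this
    have h := key S hS hSne c
    rw [hsum, hcard, ← hn] at h
    -- The estimate relies on n being an integer.
    have hn' : 4 ≤ n ∨ n ≤ 3 := by
      rcases Nat.lt_or_ge 3 W.card with h | h
      · left; rw [hn]; exact_mod_cast h
      · right; rw [hn]; exact_mod_cast h
    -- With s = d x + d y, the last bracket of `hsum` equals (2n - s)s/2 + (d x - d y)²/2.
    -- Subtracting the half from 4403/7500 leaves the coefficient 653/7500.
    have := edge_estimate hn' hx1 hy1 (Ple x) (Ple y) (leP x y hxy)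
      (leP y x (by rw [asymm, hxy])) (vert x hx) (vert y hy)
    linarith
  have main := sum_edge_defect_le (q := fun u v => 1 - g u v) a01
    (fun u v => by rcases g01 u v with h | h <;> simp [h]) asymm
    (fun u v => by simp [gsymm u v]) tri (fun u v w => by simp [hag]) W hd hP
  -- An edge is needed for strictness. Without one, `vert` would force P u < 1, although u counts
  -- among its own non-neighbours.
  obtain ⟨x₀, hx₀, y₀, hy₀, hxy₀⟩ : ∃ x ∈ W, ∃ y ∈ W, a x y = 1 := by
    by_contra! hno
    obtain ⟨u, hu⟩ := hne
    have hdu : d u = 0 := sum_eq_zero fun v hv => (a01 u v).resolve_right (hno u hu v hv)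
    have h1 := vert u hu
    have h2 : 1 ≤ P u := by
      have : 1 - g u u ≤ P u := single_le_sum (f := fun v => 1 - g u v)
        (fun v _ => by rcases g01 u v with h | h <;> simp [h]) hu
      rwa [gself, sub_zero] at this
    have h3 : 1 ≤ n := by
      rw [hn]
      exact_mod_cast card_pos.2 ⟨u, hu⟩
    linarith
  have nonneg : ∀ x ∈ W, ∀ y ∈ W, 0 ≤ a x y * (2 * ∑ u ∈ W, (a x u + a y u) * d u
        - 2 * ∑ u ∈ W, ∑ v ∈ W, a x u * a y v * a u v
        + 2 * ∑ u ∈ W, ∑ v ∈ W, a x u * a y v * (1 - g u v)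
        - ∑ u ∈ W, (a x u + a y u) * P u) - a x y * ((P x - P y) * (d x - d y)) := by
    intro x hx y hy
    rcases a01 x y with h | h
    · simp [h]
    · have := edge x hx y hy h
      rw [h]
      linarith
  have pos : 0 < ∑ x ∈ W, ∑ y ∈ W, (a x y * (2 * ∑ u ∈ W, (a x u + a y u) * d u
        - 2 * ∑ u ∈ W, ∑ v ∈ W, a x u * a y v * a u v
        + 2 * ∑ u ∈ W, ∑ v ∈ W, a x u * a y v * (1 - g u v)
        - ∑ u ∈ W, (a x u + a y u) * P u) - a x y * ((P x - P y) * (d x - d y))) := by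
    refine sum_pos' (fun x hx => sum_nonneg fun y hy => nonneg x hx y hy) ⟨x₀, hx₀, ?_⟩
    refine sum_pos' (fun y hy => nonneg x₀ hx₀ y hy) ⟨y₀, hy₀, ?_⟩
    have := edge x₀ hx₀ y₀ hy₀ hxy₀
    rw [hxy₀]
    linarith
  simp only [sum_sub_distrib (s := W)] at pos
  linarith

/-! ### From ordered pairs back to edge sets -/

/-- A set of edges of a graph, counted by ordered pairs of vertices. -/
theorem sum_indicator_mem_eq_two_mul_card {V : Type*} [Fintype V] (G : SimpleGraph V)
    (A : Finset (Sym2 V)) (hA : (A : Set (Sym2 V)) ⊆ G.edgeSet) :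
    ∑ u : V, ∑ v : V, (open Classical in if s(u, v) ∈ A then (1 : ℝ) else 0) = 2 * A.card := by
  classical
  have hset : (SimpleGraph.fromEdgeSet (A : Set (Sym2 V))).edgeSet = A := by
    rw [SimpleGraph.edgeSet_fromEdgeSet]
    refine sdiff_eq_left.2 (Set.disjoint_left.2 fun e he hd => ?_)
    exact G.not_isDiag_of_mem_edgeSet (hA he) hd
  have h := (SimpleGraph.fromEdgeSet (A : Set (Sym2 V))).sum_degrees_eq_twice_card_edges
  have hc : ∀ _ : Fintype (SimpleGraph.fromEdgeSet (A : Set (Sym2 V))).edgeSet,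
      (SimpleGraph.fromEdgeSet (A : Set (Sym2 V))).edgeFinset = A := by
    intro _
    ext e
    rw [SimpleGraph.mem_edgeFinset, hset, Finset.mem_coe]
  rw [hc] at h
  have hdeg : ∀ u, ∑ v : V, (if s(u, v) ∈ A then (1 : ℝ) else 0) =
      (SimpleGraph.fromEdgeSet (A : Set (Sym2 V))).degree u := fun u => by
    rw [← SimpleGraph.card_neighborFinset_eq_degree, SimpleGraph.neighborFinset_eq_filter,
      Finset.sum_boole]
    congr 2
    ext v
    rw [Finset.mem_filter, Finset.mem_filter, ← SimpleGraph.mem_edgeSet, hset, Finset.mem_coe]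
  simp only [hdeg]
  exact_mod_cast h

theorem theoremt {V : Type*} [Fintype V] (G : SimpleGraph V) (hG : G.CliqueFree 6) :
    (alphaOne G : ℝ) + (tauB G : ℝ) ≤ 4403 * (Fintype.card V : ℝ) ^ 2 / 15000 := by
  classical
  obtain ⟨⟨A, ⟨hAG, hA⟩, hAcard⟩, -⟩ := alphaOne_isGreatest G
  have hadj : ∀ u v, s(u, v) ∈ A → G.Adj u v := fun u v h => by
    simpa using hAG (Finset.mem_coe.2 h)
  obtain ⟨c, hc⟩ := exists_coloring_sum_le
    (a := fun u v => if s(u, v) ∈ A then (1 : ℝ) else 0)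
    (g := fun u v => if G.Adj u v then (1 : ℝ) else 0)
    (fun u v => by by_cases h : s(u, v) ∈ A <;> simp [h])
    (fun u v => by by_cases h : G.Adj u v <;> simp [h])
    (fun u v => by simp only [Sym2.eq_swap]) (fun u v => by simp only [G.adj_comm])
    (fun u => by simp)
    (fun u v => by
      by_cases h : s(u, v) ∈ A
      · simp [h, hadj u v h]
      · simp only [h, if_false]; positivity)
    (fun u v w => by
      by_contra hne
      have hu : s(u, w) ∈ A := by by_contra h; simp [h] at hne
      have hv : s(v, w) ∈ A := by by_contra h; simp [h] at hne
      have huv : G.Adj u v := by by_contra h; simp [h] at hne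
      have ht : G.IsNClique 3 {u, v, w} :=
        SimpleGraph.is3Clique_triple_iff.2 ⟨huv, hadj u w hu, hadj v w hv⟩
      have := hA _ ht _ hu _ hv (by simp) (by simp)
      rcases Sym2.eq_iff.1 this with h | h
      · exact huv.ne h.1
      · exact (hadj u w hu).ne h.1)
    Finset.univ
  let D : Finset (Sym2 V) := G.edgeFinset.filter fun e => ∃ b, ∀ v ∈ e, c v = b
  have hD : ∀ u v, s(u, v) ∈ D ↔ G.Adj u v ∧ c u = c v := fun u v => by
    simp only [D, Finset.mem_filter, SimpleGraph.mem_edgeFinset, SimpleGraph.mem_edgeSet,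
      Sym2.mem_iff, forall_eq_or_imp, forall_eq]
    exact and_congr_right fun _ => ⟨fun ⟨b, h1, h2⟩ => h1.trans h2.symm, fun h => ⟨_, h, rfl⟩⟩
  have hDG : (D : Set (Sym2 V)) ⊆ G.edgeSet := fun e he => by
    simpa using (Finset.mem_filter.1 (Finset.mem_coe.1 he)).1
  have hDb : IsBipartizing G D := by
    refine ⟨hDG, ⟨SimpleGraph.Coloring.mk (fun v => if c v then 0 else 1) ?_⟩⟩
    intro u v h
    rw [SimpleGraph.deleteEdges_adj, Finset.mem_coe, hD] at h
    have hne : c u ≠ c v := fun h' => h.2 ⟨h.1, h'⟩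
    cases hu : c u <;> cases hv : c v <;> simp_all
  have htau : tauB G ≤ D.card := (tauB_isLeast G).2 ⟨D, hDb, rfl⟩
  have hsA := sum_indicator_mem_eq_two_mul_card G A hAG
  have hsD := sum_indicator_mem_eq_two_mul_card G D hDG
  have hsum : ∑ u : V, ∑ v : V, ((if s(u, v) ∈ A then (1 : ℝ) else 0) +
      (if G.Adj u v then (1 : ℝ) else 0) * (if c u = c v then 1 else 0)) =
      2 * A.card + 2 * D.card := by
    rw [← hsA, ← hsD]
    simp only [Finset.sum_add_distrib]
    congr 1
    refine Finset.sum_congr rfl fun u _ => Finset.sum_congr rfl fun v _ => ?_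
    by_cases h1 : G.Adj u v <;> by_cases h2 : c u = c v <;> simp [hD, h1, h2]
  rw [hsum, Finset.card_univ] at hc
  have : (tauB G : ℝ) ≤ D.card := by exact_mod_cast htau
  rw [← hAcard]
  linarith
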